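/- Let $n\ge 1$ and $p\ge 1$ be integers, and let $X_1,\ldots,X_n$ be independent real random variables with $\mathbb{E}|X_i|^{p+1}<\infty$ for $1\le i\le n$. Let $Z$ be a standard normal random variable, and for $1\le i\le n$ and integers $0\le k\le p$ put $\epsilon_{i,k}=\mathbb{E}X_i^k-\mathbb{E}Z^k$. Let $W_n=\frac{1}{\sqrt n}\sum_{i=1}^nX_i$, let $\|g\|=\sup_{x\in\mathbb{R}}|g(x)|$, and let $C_b^{p+1}(\mathbb{R})$ be the class of bounded functions $h:\mathbb{R}\to\mathbb{R}$ that are $p+1$ times differentiable with bounded derivatives of every order $k\le p+1$. Then, for all $h\in C_b^{p+1}(\mathbb{R})$, with $\Phi h=\mathbb{E}h(Z)$, \[ |\mathbb{E}h(W_n)-\Phi h|\le \frac{\|h'\|}{\sqrt n}\sum_{i=1}^n|\epsilon_{i,1}|+\sum_{i=1}^n\sum_{k=1}^{p-1}\frac{N_k}{k!\,n^{(k+1)/2}}\,|k\epsilon_{i,k-1}-\epsilon_{i,k+1}|+\frac{N_p}{n^{(p+1)/2}}\sum_{i=1}^n\bigg(\frac{\mathbb{E}|X_i|^{p-1}}{(p-1)!}+\frac{\mathbb{E}|X_i|^{p+1}}{p!}\bigg),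 \] where, for $1\le k\le p$, \[ N_k=\min\bigg\{3\|h^{(k-1)}\|,\ \frac{\Gamma(\frac{k+1}{2})\,\|h^{(k)}\|}{\sqrt2\,\Gamma(\frac k2+1)},\ \frac{\|h^{(k+1)}\|}{k+1}\bigg\}. \] (For $p=1$ the double sum is empty and $\mathbb{E}|X_i|^{0}=1$.) -/

import Mathlib

open MeasureTheory ProbabilityTheory

noncomputable section

namespace SteinMoments

/-- The supremum norm `sup_x |f x|`; only used for bounded `f`. -/
def supNorm (f : ℝ → ℝ) : ℝ := ⨆ x : ℝ, |f x|

/-- `C_b^m(ℝ)`: bounded functions that are `m` times differentiable, with bounded derivatives of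
every order up to `m`. Continuity of the `m`-th derivative is not required, so for `m ≥ 1` this
contains every `m` times continuously differentiable function with bounded derivatives. -/
structure MemCb (m : ℕ) (h : ℝ → ℝ) : Prop where
  differentiable : ∀ k < m, Differentiable ℝ (iteratedDeriv k h)
  bounded : ∀ k ≤ m, ∃ C : ℝ, ∀ x : ℝ, |iteratedDeriv k h x| ≤ C

/-- `Φh = E h(Z)` for a standard normal `Z`. -/
def normalMean (h : ℝ → ℝ) : ℝ := ∫ z, h z ∂(gaussianReal 0 1)

/-- The moment mismatch `E Y^k - E Z^k`, with `Z` standard normal. -/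
def momentDiff {Ω : Type*} [MeasurableSpace Ω] (μ : Measure Ω) (Y : Ω → ℝ) (k : ℕ) : ℝ :=
  (∫ ω, Y ω ^ k ∂μ) - ∫ z, z ^ k ∂(gaussianReal 0 1)

/-- The constant `N_k`, for `k ≥ 1`. -/
def steinConst (h : ℝ → ℝ) (k : ℕ) : ℝ :=
  min (3 * supNorm (iteratedDeriv (k - 1) h))
    (min (Real.Gamma (((k : ℝ) + 1) / 2) * supNorm (iteratedDeriv k h)
        / (Real.sqrt 2 * Real.Gamma ((k : ℝ) / 2 + 1)))
      (supNorm (iteratedDeriv (k + 1) h) / ((k : ℝ) + 1)))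

/-- The standardised sum `W_n = n^{-1/2} (X_1 + ⋯ + X_n)`. -/
def stdSum {Ω : Type*} {n : ℕ} (X : Fin n → Ω → ℝ) (ω : Ω) : ℝ :=
  (1 / Real.sqrt (n : ℝ)) * ∑ i, X i ω

end SteinMoments

end

namespace SteinMoments

noncomputable section


/-! Stein's method with a Taylor expansion. The equation f'(x) - x f(x) = h(x) - Φh has a solution
with f^(k)(x) = -∫₀¹ u^k E h^(k+1)(ux + √(1-u²) Z) du (`steinDeriv`). Writing u = sin θ gives the
weight cos θ dθ, which absorbs the 1/cos θ produced by Gaussian integration by parts.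

Each entry of N_k bounds f^(k). Bounding h^(k+1) directly gives ‖h^(k+1)‖/(k+1). One integration by
parts in Z gives E|Z| ‖h^(k)‖ times a Wallis integral, which is the Gamma quotient. For the
remaining entry, the differentiated Stein equation is a linear ODE whose bounded solutions obey
`abs_mul_add_le`; this yields 2‖h^(k-1)‖, better than the 3 required.

With s = n^(-1/2), E h(W) - Φh is the sum over i of E[s² f'(W) - s X_i f(W)]. Expand f' and f around
U = W - s X_i, which is independent of X_i. The terms in f^(k)(U) combine to s^(k+1)/k! (k X_i^(k-1)
- X_i^(k+1)), and E Z^(k+1) = k E Z^(k-1) turns their expectations into moment mismatches. Both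
remainders involve only f^(p), bounded by N_p. -/

/-! ### Gaussian integration by parts, moments, and the Wallis integral -/

lemma integrable_gaussianReal_iff {f : ℝ → ℝ} :
    Integrable f (gaussianReal 0 1) ↔ Integrable (fun x => gaussianPDFReal 0 1 x * f x) := by
  rw [gaussianReal_of_var_ne_zero _ one_ne_zero,
    integrable_withDensity_iff_integrable_smul' (measurable_gaussianPDF _ _)
      (ae_of_all _ fun _ ↦ gaussianPDF_lt_top)]
  simp

lemma hasDerivAt_gaussianPDFReal (x : ℝ) :
    HasDerivAt (gaussianPDFReal 0 1) (-(x * gaussianPDFReal 0 1 x)) x := by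
  have h1 : HasDerivAt (fun y : ℝ => -(y - 0) ^ 2 / (2 * ((1 : NNReal) : ℝ))) (-x) x := by
    have := ((((hasDerivAt_id x).sub_const 0).pow 2).neg).div_const (2 * ((1 : NNReal) : ℝ))
    convert! this using 1
    simp
    ring
  have h2 := (h1.exp).const_mul ((√(2 * Real.pi * ((1 : NNReal) : ℝ)))⁻¹)
  convert! h2 using 1
  simp only [gaussianPDFReal]
  ring

/-- Gaussian integration by parts. -/
lemma integral_mul_gaussianReal {g g' : ℝ → ℝ} (hg : ∀ x, HasDerivAt g (g' x) x)
    (h0 : Integrable g (gaussianReal 0 1)) (h1 : Integrable (fun x => x * g x) (gaussianReal 0 1))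
    (h2 : Integrable g' (gaussianReal 0 1)) :
    ∫ x, x * g x ∂(gaussianReal 0 1) = ∫ x, g' x ∂(gaussianReal 0 1) := by
  rw [integrable_gaussianReal_iff] at h0 h1 h2
  rw [integral_gaussianReal_eq_integral_smul one_ne_zero,
    integral_gaussianReal_eq_integral_smul one_ne_zero]
  have := integral_mul_deriv_eq_deriv_mul_of_integrable (u := g) (u' := g')
    (v := gaussianPDFReal 0 1) (v' := fun x => -(x * gaussianPDFReal 0 1 x))
    (fun x _ => hg x) (fun x _ => hasDerivAt_gaussianPDFReal x)
    (by convert! h1.neg using 1; ext x; simp; ring)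
    (by convert! h2 using 1; ext x; simp; ring)
    (by convert! h0 using 1; ext x; simp; ring)
  simp only [mul_neg, integral_neg, neg_inj] at this
  calc ∫ x, gaussianPDFReal 0 1 x • (x * g x) = ∫ x, g x * (x * gaussianPDFReal 0 1 x) := by
        congr 1 with x; simp only [smul_eq_mul]; ring
    _ = ∫ x, g' x * gaussianPDFReal 0 1 x := this
    _ = ∫ x, gaussianPDFReal 0 1 x • g' x := by
        congr 1 with x; simp only [smul_eq_mul]; ring

lemma integrable_pow_gaussianReal (k : ℕ) :
    Integrable (fun x : ℝ => x ^ k) (gaussianReal 0 1) := by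
  have := (memLp_id_gaussianReal (μ := 0) (v := 1) (k : NNReal)).integrable_norm_pow'
  refine (integrable_norm_iff (by fun_prop)).1 ?_
  simpa using this

/-- The recursion for the standard normal moments. -/
lemma integral_pow_gaussianReal (k : ℕ) :
    ∫ x, x ^ (k + 2) ∂(gaussianReal 0 1) = (k + 1 : ℝ) * ∫ x, x ^ k ∂(gaussianReal 0 1) := by
  have := integral_mul_gaussianReal (g := fun x => x ^ (k + 1)) (g' := fun x => (k + 1 : ℝ) * x ^ k)
    (fun x => by simpa using hasDerivAt_pow (k + 1) x) (integrable_pow_gaussianReal _)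
    (by simpa only [← pow_succ'] using integrable_pow_gaussianReal (k + 2))
    ((integrable_pow_gaussianReal k).const_mul _)
  rw [← integral_const_mul, ← this]
  congr 1 with x
  ring

lemma integral_abs_gaussianReal : ∫ x, |x| ∂(gaussianReal 0 1) = √2 / √Real.pi := by
  rw [integral_gaussianReal_eq_integral_smul one_ne_zero]
  have h1 := integral_comp_abs (f := fun x => gaussianPDFReal 0 1 x * x)
  have h2 := integral_rpow_mul_exp_neg_mul_rpow (p := 2) (q := 1) (b := 1 / 2)
    (by norm_num) (by norm_num) (by norm_num)
  have h3 : ∫ x in Set.Ioi (0 : ℝ), gaussianPDFReal 0 1 x * x = (√(2 * Real.pi))⁻¹ := by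
    have : ∫ x in Set.Ioi (0 : ℝ), gaussianPDFReal 0 1 x * x
        = (√(2 * Real.pi))⁻¹ * ∫ x in Set.Ioi (0 : ℝ), x ^ (1 : ℝ) * Real.exp (-(1 / 2) * x ^ (2 : ℝ)) := by
      rw [← integral_const_mul]
      congr 1 with x
      simp only [gaussianPDFReal, NNReal.coe_one, mul_one, sub_zero, Real.rpow_one, Real.rpow_ofNat]
      rw [show -(1 / 2) * x ^ 2 = -x ^ 2 / 2 by ring]
      ring
    rw [this, h2]
    norm_num [Real.rpow_neg_one]
  have h4 : ∀ x : ℝ, gaussianPDFReal 0 1 x • |x| = gaussianPDFReal 0 1 |x| * |x| := by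
    intro x; simp [gaussianPDFReal]
  simp_rw [h4]
  rw [h1, h3, Real.sqrt_mul (by norm_num)]
  have : √2 * √2 = (2 : ℝ) := Real.mul_self_sqrt (by norm_num)
  field_simp
  linarith

/-- The two-step recursion for powers of sine matches Γ(t+1) = tΓ(t). Multiplied by E|Z|, this
becomes the Gamma entry of N_k. -/
lemma integral_sin_pow_pi_div_two (m : ℕ) :
    ∫ θ in (0 : ℝ)..(Real.pi / 2), Real.sin θ ^ m
      = √Real.pi / 2 * (Real.Gamma (((m : ℝ) + 1) / 2) / Real.Gamma ((m : ℝ) / 2 + 1)) := by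
  induction m using Nat.twoStepInduction with
  | zero =>
    have := Real.mul_self_sqrt Real.pi_pos.le
    simp only [pow_zero, intervalIntegral.integral_const, smul_eq_mul, mul_one, sub_zero,
      Nat.cast_zero, zero_add, zero_div, Real.Gamma_one, Real.Gamma_one_half_eq, div_one]
    linarith
  | one =>
    have h1 : Real.Gamma ((1 : ℝ) / 2 + 1) = 1 / 2 * √Real.pi := by
      rw [Real.Gamma_add_one (by norm_num), Real.Gamma_one_half_eq]
    have := Real.sqrt_pos.2 Real.pi_pos
    simp only [pow_one, integral_sin, Real.cos_zero, Real.cos_pi_div_two, Nat.cast_one, h1]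
    norm_num
    field_simp
  | more m ih _ =>
    rw [integral_sin_pow, ih]
    have e1 : Real.Gamma (((m + 2 : ℕ) + 1 : ℝ) / 2)
        = ((m : ℝ) + 1) / 2 * Real.Gamma (((m : ℝ) + 1) / 2) := by
      rw [← Real.Gamma_add_one (by positivity)]; congr 1; push_cast; ring
    have e2 : Real.Gamma ((m + 2 : ℕ) / 2 + 1 : ℝ)
        = ((m : ℝ) / 2 + 1) * Real.Gamma ((m : ℝ) / 2 + 1) := by
      rw [← Real.Gamma_add_one (by positivity)]; congr 1; push_cast; ring
    rw [e1, e2]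
    have : 0 < Real.Gamma ((m : ℝ) / 2 + 1) := Real.Gamma_pos_of_pos (by positivity)
    simp only [Real.sin_zero, Real.cos_pi_div_two, mul_zero, sub_zero]
    rw [zero_pow (by omega)]
    field_simp
    ring

/-! ### Bounded solutions of the differentiated Stein equation -/

/-- If `v' = x v + A + g` and `A' = m v` with `v` bounded and `|A|, |g| ≤ M`, then
`x v + A ≤ M` on the half-line `x ≥ 0`. -/
lemma mul_add_le_of_nonneg {v A g : ℝ → ℝ} {m M C : ℝ} (hm : 0 ≤ m)
    (hv : ∀ x, HasDerivAt v (x * v x + A x + g x) x) (hA : ∀ x, HasDerivAt A (m * v x) x)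
    (hAM : ∀ x, |A x| ≤ M) (hgM : ∀ x, |g x| ≤ M) (hC : ∀ x, |v x| ≤ C) {a : ℝ} (ha : 0 ≤ a) :
    a * v a + A a ≤ M := by
  by_contra! hlt
  -- If H(a) > M, then v' = H + g is at least c - M > 0 while H ≥ c, and H' = x(H + g) + (m+1)v is
  -- nonnegative. So H never drops to c, and v grows linearly, against its boundedness.
  set H : ℝ → ℝ := fun x => x * v x + A x with hH
  have hva : 0 ≤ v a := by
    by_contra! hneg
    have := (abs_le.1 (hAM a)).2
    nlinarith [mul_nonneg ha (neg_nonneg.2 hneg.le)]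
  have hHd : ∀ x, HasDerivAt H (x * (H x + g x) + (m + 1) * v x) x := by
    intro x
    convert! ((hasDerivAt_id x).mul (hv x)).add (hA x) using 1
    simp only [hH, id]
    ring
  have hvc : Continuous v := continuous_iff_continuousAt.2 fun x => (hv x).continuousAt
  have hHc : Continuous H := continuous_iff_continuousAt.2 fun x => (hHd x).continuousAt
  obtain ⟨c, hMc, hca⟩ := exists_between hlt
  have hmono : ∀ b, a ≤ b → (∀ x ∈ Set.Icc a b, c ≤ H x) →
      v a + (c - M) * (b - a) ≤ v b := by
    intro b hab hb
    have : MonotoneOn (fun x => v x - (c - M) * x) (Set.Icc a b) := by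
      refine monotoneOn_of_hasDerivWithinAt_nonneg (f' := fun x => H x + g x - (c - M))
        (convex_Icc a b) (by fun_prop) (fun x _ => ?_) (fun x hx => ?_)
      · have := (hv x).sub ((hasDerivAt_id x).const_mul (c - M))
        convert! this.hasDerivWithinAt using 1
        simp [hH]
      · rw [interior_Icc] at hx
        have h1 := hb x (Set.Ioo_subset_Icc_self hx)
        have h2 := (abs_le.1 (hgM x)).1
        linarith
    have := this (Set.left_mem_Icc.2 hab) (Set.right_mem_Icc.2 hab) hab
    simp only at this
    linarith
  have key : ∀ b, a ≤ b → c ≤ H b := by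
    by_contra! hcon
    obtain ⟨b, hab, hb⟩ := hcon
    -- Take the first point x₀ where H ≤ c. Before it H increases, so H(a) ≤ H(x₀) ≤ c,
    -- contradicting c < H(a).
    set S : Set ℝ := Set.Icc a b ∩ {x | H x ≤ c} with hS
    have hSc : IsCompact S := isCompact_Icc.inter_right (isClosed_le hHc continuous_const)
    obtain ⟨x₀, ⟨hx₀, hx₀c⟩, hmin⟩ :=
      hSc.exists_isLeast ⟨b, Set.right_mem_Icc.2 hab, hb.le⟩
    have hge : ∀ x ∈ Set.Ico a x₀, c < H x := by
      intro x hx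
      by_contra! hxc
      exact absurd (hmin ⟨⟨hx.1, hx.2.le.trans hx₀.2⟩, hxc⟩) (not_le.2 hx.2)
    have hmonoH : MonotoneOn H (Set.Icc a x₀) := by
      refine monotoneOn_of_hasDerivWithinAt_nonneg (convex_Icc a x₀) (by fun_prop)
        (fun x _ => (hHd x).hasDerivWithinAt) (fun x hx => ?_)
      rw [interior_Icc] at hx
      have h1 := hge x ⟨hx.1.le, hx.2⟩
      have h2 := (abs_le.1 (hgM x)).1
      have h3 := hmono x hx.1.le fun y hy => (hge y ⟨hy.1, hy.2.trans_lt hx.2⟩).le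
      have h4 : 0 ≤ v x := by nlinarith [hx.1]
      have h5 : 0 ≤ x := ha.trans hx.1.le
      have h6 : 0 ≤ H x + g x := by linarith
      positivity
    have h1 := hmonoH (Set.left_mem_Icc.2 hx₀.1) (Set.right_mem_Icc.2 hx₀.1) hx₀.1
    have h2 : H x₀ ≤ c := hx₀c
    exact absurd hca (not_lt.2 (h1.trans h2))
  have hC0 : 0 ≤ C := (abs_nonneg _).trans (hC 0)
  have hpos : 0 < c - M := sub_pos.2 hMc
  -- Over this length, growth at rate c - M raises v by C + 1, past its bound C.
  have hle : a ≤ a + (C + 1) / (c - M) := by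
    have : 0 ≤ (C + 1) / (c - M) := by positivity
    linarith
  have h1 := hmono _ hle fun x hx => key x hx.1
  have h2 := (abs_le.1 (hC (a + (C + 1) / (c - M)))).2
  rw [add_sub_cancel_left, mul_div_cancel₀ _ hpos.ne'] at h1
  linarith

/-- If `v' = x v + A + g` and `A' = m v` with `v` bounded and `|A|, |g| ≤ M`, then
`|x v + A| ≤ M`. -/
lemma abs_mul_add_le {v A g : ℝ → ℝ} {m M C : ℝ} (hm : 0 ≤ m)
    (hv : ∀ x, HasDerivAt v (x * v x + A x + g x) x) (hA : ∀ x, HasDerivAt A (m * v x) x)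
    (hAM : ∀ x, |A x| ≤ M) (hgM : ∀ x, |g x| ≤ M) (hC : ∀ x, |v x| ≤ C) (a : ℝ) :
    |a * v a + A a| ≤ M := by
  -- the equations are invariant under `(v, A, g) ↦ (-v, -A, -g)` and under reflection
  have upper : ∀ {v A g : ℝ → ℝ}, (∀ x, HasDerivAt v (x * v x + A x + g x) x) →
      (∀ x, HasDerivAt A (m * v x) x) → (∀ x, |A x| ≤ M) → (∀ x, |g x| ≤ M) →
      (∀ x, |v x| ≤ C) → ∀ a, a * v a + A a ≤ M := by
    intro v A g hv hA hAM hgM hC a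
    rcases le_total 0 a with ha | ha
    · exact mul_add_le_of_nonneg hm hv hA hAM hgM hC ha
    · have := mul_add_le_of_nonneg (v := fun x => -v (-x)) (A := fun x => A (-x))
        (g := fun x => g (-x)) hm
        (fun x => by
          convert! ((hv (-x)).comp x (hasDerivAt_neg x)).neg using 1
          ring)
        (fun x => by
          convert! (hA (-x)).comp x (hasDerivAt_neg x) using 1
          ring)
        (fun x => hAM _) (fun x => hgM _) (fun x => by simpa using hC (-x))
        (neg_nonneg.2 ha)
      simpa using this
  refine abs_le.2 ⟨?_, upper hv hA hAM hgM hC a⟩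
  have := upper (v := fun x => -v x) (A := fun x => -A x) (g := fun x => -g x)
    (fun x => by convert! (hv x).neg using 1; ring)
    (fun x => by convert! (hA x).neg using 1; ring)
    (by simpa using hAM) (by simpa using hgM) (by simpa using hC) a
  simp only [mul_neg] at this
  linarith

/-! ### Taylor's formula with bounded last derivative -/

/-- Taylor's formula to the right with a bounded, possibly discontinuous, last derivative. -/
lemma abs_sub_taylor_le_of_nonneg (m : ℕ) {F : ℕ → ℝ → ℝ} {C : ℝ}
    (hF : ∀ k < m, ∀ x, HasDerivAt (F k) (F (k + 1) x) x) (hC : ∀ x, |F m x| ≤ C) (w : ℝ)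
    {t : ℝ} (ht : 0 ≤ t) :
    |F 0 (w + t) - ∑ k ∈ Finset.range m, F k w * t ^ k / (k.factorial : ℝ)|
      ≤ C * t ^ m / (m.factorial : ℝ) := by
  induction m generalizing F t with
  | zero => simpa using hC (w + t)
  | succ m ih =>
    have hd : ∀ s, HasDerivAt (fun s => F 0 (w + s)
          - ∑ k ∈ Finset.range (m + 1), F k w * s ^ k / (k.factorial : ℝ))
        (F 1 (w + s) - ∑ k ∈ Finset.range m, F (k + 1) w * s ^ k / (k.factorial : ℝ)) s := by
      intro s
      have h1 : HasDerivAt (fun s => F 0 (w + s)) (F 1 (w + s)) s := by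
        simpa using (hF 0 (by omega) (w + s)).comp_const_add w s
      refine h1.sub ?_
      simp_rw [Finset.sum_range_succ']
      simp only [pow_zero, Nat.factorial_zero, Nat.cast_one, mul_one, div_one]
      refine HasDerivAt.add_const _ (HasDerivAt.fun_sum fun k _ => ?_)
      have := ((hasDerivAt_pow (k + 1) s).const_mul (F (k + 1) w)).div_const
        ((k + 1).factorial : ℝ)
      convert! this using 1
      rw [Nat.factorial_succ]
      push_cast
      have : (k.factorial : ℝ) ≠ 0 := by positivity
      field_simp
    -- The derivative of the remainder is the remainder of one order less for the shifted family, so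
    -- the mean value inequality integrates the induction bound without integrability of `F (m +
    -- 1)`.
    refine image_norm_le_of_norm_deriv_right_le_deriv_boundary (a := 0) (b := t)
      (B := fun s => C * s ^ (m + 1) / ((m + 1).factorial : ℝ))
      (B' := fun s => C * s ^ m / (m.factorial : ℝ))
      (fun s _ => (hd s).continuousAt.continuousWithinAt)
      (fun s _ => (hd s).hasDerivWithinAt) ?_ (fun s => ?_) (fun s hs => ?_)
      (Set.right_mem_Icc.2 ht)
    · simp [Finset.sum_range_succ']
    · convert! ((hasDerivAt_pow (m + 1) s).const_mul C).div_const ((m + 1).factorial : ℝ) using 1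
      rw [Nat.factorial_succ]
      push_cast
      have : (m.factorial : ℝ) ≠ 0 := by positivity
      field_simp
    · exact ih (F := fun k => F (k + 1)) (fun k hk => hF (k + 1) (by omega)) hC hs.1

/-- Taylor's formula with a bounded, possibly discontinuous, last derivative. -/
lemma abs_sub_taylor_le (m : ℕ) {F : ℕ → ℝ → ℝ} {C : ℝ}
    (hF : ∀ k < m, ∀ x, HasDerivAt (F k) (F (k + 1) x) x) (hC : ∀ x, |F m x| ≤ C) (w t : ℝ) :
    |F 0 (w + t) - ∑ k ∈ Finset.range m, F k w * t ^ k / (k.factorial : ℝ)|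
      ≤ C * |t| ^ m / (m.factorial : ℝ) := by
  rcases le_total 0 t with ht | ht
  · rw [abs_of_nonneg ht]
    exact abs_sub_taylor_le_of_nonneg m hF hC w ht
  · have := abs_sub_taylor_le_of_nonneg m (F := fun k x => (-1) ^ k * F k (-x)) (C := C)
      (fun k hk x => by
        convert! ((hF k hk (-x)).comp x (hasDerivAt_neg x)).const_mul ((-1 : ℝ) ^ k) using 1
        ring)
      (fun x => by simpa [abs_mul] using hC (-x)) (-w) (neg_nonneg.2 ht)
    rw [abs_of_nonpos ht]
    convert! this using 2
    simp only [pow_zero, one_mul, neg_neg, neg_add]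
    congr 1
    refine Finset.sum_congr rfl fun k _ => ?_
    rw [neg_pow t k]
    have : ((-1 : ℝ) ^ k) * (-1) ^ k = 1 := by rw [← mul_pow]; simp
    linear_combination (-(F k w * t ^ k / (k.factorial : ℝ))) * this


/-! ### Averages along the Gaussian rotation -/

/-- Lebesgue measure on `(0, π/2]` times the standard normal law. -/
def angleGaussian : Measure (ℝ × ℝ) :=
  (volume.restrict (Set.Ioc 0 (Real.pi / 2))).prod (gaussianReal 0 1)

instance : IsFiniteMeasure angleGaussian := by
  unfold angleGaussian; infer_instance

/-- The average `∫₀^{π/2} sin^m θ cos θ E g(x sin θ + Z cos θ) dθ`; with `u = sin θ` this is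
`∫₀¹ u^m E g(u x + √(1 - u²) Z) du`. -/
def mehlerAvg (m : ℕ) (g : ℝ → ℝ) (x : ℝ) : ℝ :=
  ∫ q, Real.sin q.1 ^ m * Real.cos q.1 * g (x * Real.sin q.1 + Real.cos q.1 * q.2) ∂angleGaussian

lemma integrable_comp_rotation {g : ℝ → ℝ} (hg : Measurable g) {C : ℝ} (hC : ∀ x, |g x| ≤ C)
    (m : ℕ) (x : ℝ) :
    Integrable (fun q : ℝ × ℝ => Real.sin q.1 ^ m * Real.cos q.1
      * g (x * Real.sin q.1 + Real.cos q.1 * q.2)) angleGaussian := by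
  refine Integrable.of_bound (C := C) (Measurable.aestronglyMeasurable (by fun_prop))
    (ae_of_all _ fun q => ?_)
  rw [norm_mul, norm_mul, norm_pow, Real.norm_eq_abs, Real.norm_eq_abs, Real.norm_eq_abs]
  have h1 : |Real.sin q.1| ^ m ≤ 1 := pow_le_one₀ (abs_nonneg _) (Real.abs_sin_le_one _)
  have h2 := Real.abs_cos_le_one q.1
  have h3 : |Real.sin q.1| ^ m * |Real.cos q.1| ≤ 1 :=
    mul_le_one₀ h1 (abs_nonneg _) h2
  calc _ ≤ 1 * C := mul_le_mul h3 (hC _) (abs_nonneg _) zero_le_one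
    _ = C := one_mul C

/-- Differentiation under the integral brings out one factor sin θ. Since g' is measurable as a
derivative, its boundedness suffices for domination. -/
lemma hasDerivAt_mehlerAvg {g g' : ℝ → ℝ} (hg : ∀ x, HasDerivAt g (g' x) x)
    {C C' : ℝ} (hC : ∀ x, |g x| ≤ C) (hC' : ∀ x, |g' x| ≤ C') (m : ℕ) (x : ℝ) :
    HasDerivAt (mehlerAvg m g) (mehlerAvg (m + 1) g' x) x := by
  have hgm : Measurable g :=
    (continuous_iff_continuousAt.2 fun x => (hg x).continuousAt).measurable
  have hgm' : Measurable g' := by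
    rw [show g' = deriv g from funext fun x => (hg x).deriv.symm]
    exact measurable_deriv g
  have hd := (hasDerivAt_integral_of_dominated_loc_of_deriv_le (x₀ := x) (μ := angleGaussian)
    (bound := fun _ => C')
    (F := fun x q => Real.sin q.1 ^ m * Real.cos q.1 * g (x * Real.sin q.1 + Real.cos q.1 * q.2))
    (F' := fun x q => Real.sin q.1 ^ (m + 1) * Real.cos q.1
      * g' (x * Real.sin q.1 + Real.cos q.1 * q.2))
    Filter.univ_mem
    (Filter.Eventually.of_forall fun y => (integrable_comp_rotation hgm hC m y).aestronglyMeasurable)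
    (integrable_comp_rotation hgm hC m x)
    (integrable_comp_rotation hgm' hC' (m + 1) x).aestronglyMeasurable
    (ae_of_all _ fun q y _ => ?_) (integrable_const _) (ae_of_all _ fun q y _ => ?_)).2
  · exact hd
  · rw [norm_mul, norm_mul, norm_pow, Real.norm_eq_abs, Real.norm_eq_abs, Real.norm_eq_abs]
    have h3 : |Real.sin q.1| ^ (m + 1) * |Real.cos q.1| ≤ 1 :=
      mul_le_one₀ (pow_le_one₀ (abs_nonneg _) (Real.abs_sin_le_one _)) (abs_nonneg _)
        (Real.abs_cos_le_one _)
    calc _ ≤ 1 * C' := mul_le_mul h3 (hC' _) (abs_nonneg _) zero_le_one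
      _ = C' := one_mul C'
  · have h1 : HasDerivAt (fun y : ℝ => y * Real.sin q.1 + Real.cos q.1 * q.2) (Real.sin q.1) y := by
      simpa using ((hasDerivAt_id y).mul_const (Real.sin q.1)).add_const (Real.cos q.1 * q.2)
    convert! ((hg _).comp y h1).const_mul (Real.sin q.1 ^ m * Real.cos q.1) using 1
    ring

/-- `E g(x sin θ + Z cos θ)`. -/
def gaussAvg (g : ℝ → ℝ) (x θ : ℝ) : ℝ :=
  ∫ z, g (x * Real.sin θ + Real.cos θ * z) ∂(gaussianReal 0 1)

lemma abs_gaussAvg_le {g : ℝ → ℝ} {C : ℝ} (hC : ∀ x, |g x| ≤ C) (x θ : ℝ) :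
    |gaussAvg g x θ| ≤ C := by
  simpa [gaussAvg] using norm_integral_le_of_norm_le_const (μ := gaussianReal 0 1)
    (f := fun z => g (x * Real.sin θ + Real.cos θ * z)) (ae_of_all _ fun z => hC _)

lemma intervalIntegrable_gaussAvg {g : ℝ → ℝ} (hg : Measurable g) {C : ℝ} (hC : ∀ x, |g x| ≤ C)
    (m : ℕ) (x : ℝ) :
    IntervalIntegrable (fun θ => Real.sin θ ^ m * Real.cos θ * gaussAvg g x θ) volume
      0 (Real.pi / 2) := by
  rw [intervalIntegrable_iff_integrableOn_Ioc_of_le (by positivity)]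
  have := (integrable_comp_rotation hg hC m x).integral_prod_left
  simpa only [integral_const_mul, gaussAvg, IntegrableOn] using this

lemma mehlerAvg_eq {g : ℝ → ℝ} (hg : Measurable g) {C : ℝ} (hC : ∀ x, |g x| ≤ C)
    (m : ℕ) (x : ℝ) :
    mehlerAvg m g x
      = ∫ θ in (0 : ℝ)..(Real.pi / 2), Real.sin θ ^ m * Real.cos θ * gaussAvg g x θ := by
  rw [mehlerAvg, intervalIntegral.integral_of_le (by positivity), angleGaussian,
    integral_prod _ (integrable_comp_rotation hg hC m x)]
  simp only [integral_const_mul, gaussAvg]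

lemma sin_nonneg_of_mem_quarter {θ : ℝ} (h : θ ∈ Set.Ioc 0 (Real.pi / 2)) : 0 ≤ Real.sin θ :=
  Real.sin_nonneg_of_nonneg_of_le_pi h.1.le (by linarith [h.2, Real.pi_pos])

lemma cos_nonneg_of_mem_quarter {θ : ℝ} (h : θ ∈ Set.Ioc 0 (Real.pi / 2)) : 0 ≤ Real.cos θ :=
  Real.cos_nonneg_of_neg_pi_div_two_le_of_le (by linarith [h.1, Real.pi_pos]) h.2

lemma abs_mehlerAvg_le {g : ℝ → ℝ} (hg : Measurable g) {C : ℝ} (hC : ∀ x, |g x| ≤ C)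
    (m : ℕ) (x : ℝ) : |mehlerAvg m g x| ≤ C / ((m : ℝ) + 1) := by
  have hint : ∫ θ in (0 : ℝ)..(Real.pi / 2), Real.sin θ ^ m * Real.cos θ * C = C / ((m : ℝ) + 1) := by
    have := intervalIntegral.integral_eq_sub_of_hasDerivAt (a := 0) (b := Real.pi / 2)
      (f := fun θ => C / ((m : ℝ) + 1) * Real.sin θ ^ (m + 1))
      (f' := fun θ => Real.sin θ ^ m * Real.cos θ * C)
      (fun θ _ => by
        convert! ((Real.hasDerivAt_sin θ).pow (m + 1)).const_mul (C / ((m : ℝ) + 1)) using 1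
        push_cast
        have : (m : ℝ) + 1 ≠ 0 := by positivity
        field_simp)
      (Continuous.intervalIntegrable (by fun_prop) _ _)
    rw [this]
    simp
  rw [mehlerAvg_eq hg hC, ← hint, ← Real.norm_eq_abs]
  refine intervalIntegral.norm_integral_le_of_norm_le (μ := volume)
    (g := fun θ => Real.sin θ ^ m * Real.cos θ * C) Real.pi_div_two_pos.le
    (ae_of_all _ fun θ hθ => ?_) (Continuous.intervalIntegrable (by fun_prop) _ _)
  have h1 := sin_nonneg_of_mem_quarter hθ
  have h2 := cos_nonneg_of_mem_quarter hθ
  rw [norm_mul, Real.norm_of_nonneg (by positivity)]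
  exact mul_le_mul_of_nonneg_left (abs_gaussAvg_le hC x θ) (by positivity)

lemma integrable_comp_affine {g : ℝ → ℝ} (hg : Measurable g) {C : ℝ} (hC : ∀ x, |g x| ≤ C)
    (a b : ℝ) : Integrable (fun z => g (a + b * z)) (gaussianReal 0 1) :=
  Integrable.of_bound (C := C) (Measurable.aestronglyMeasurable (by fun_prop))
    (ae_of_all _ fun _ => hC _)

lemma integrable_mul_comp_affine {g : ℝ → ℝ} (hg : Measurable g) {C : ℝ} (hC : ∀ x, |g x| ≤ C)
    (a b : ℝ) : Integrable (fun z => z * g (a + b * z)) (gaussianReal 0 1) := by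
  have h1 : Integrable (fun z : ℝ => z) (gaussianReal 0 1) := by
    simpa using integrable_pow_gaussianReal 1
  exact h1.mul_bdd (c := C) (integrable_comp_affine hg hC a b).aestronglyMeasurable
    (ae_of_all _ fun _ => hC _)

/-- Gaussian integration by parts in z, where the chain rule supplies cos θ: a derivative of g is
traded for a factor z. -/
lemma cos_mul_gaussAvg {g g' : ℝ → ℝ} (hg : ∀ x, HasDerivAt g (g' x) x)
    {C C' : ℝ} (hC : ∀ x, |g x| ≤ C) (hC' : ∀ x, |g' x| ≤ C') (x θ : ℝ) :
    Real.cos θ * gaussAvg g' x θ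
      = ∫ z, z * g (x * Real.sin θ + Real.cos θ * z) ∂(gaussianReal 0 1) := by
  have hgm : Measurable g :=
    (continuous_iff_continuousAt.2 fun x => (hg x).continuousAt).measurable
  have hgm' : Measurable g' := by
    rw [show g' = deriv g from funext fun x => (hg x).deriv.symm]
    exact measurable_deriv g
  rw [integral_mul_gaussianReal (g := fun z => g (x * Real.sin θ + Real.cos θ * z))
    (g' := fun z => Real.cos θ * g' (x * Real.sin θ + Real.cos θ * z)) (fun z => ?_)
    (integrable_comp_affine hgm hC _ _) (integrable_mul_comp_affine hgm hC _ _)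
    ((integrable_comp_affine hgm' hC' _ _).const_mul _), integral_const_mul, gaussAvg]
  have h1 : HasDerivAt (fun z : ℝ => x * Real.sin θ + Real.cos θ * z) (Real.cos θ) z := by
    simpa using ((hasDerivAt_id z).const_mul (Real.cos θ)).const_add (x * Real.sin θ)
  convert! (hg _).comp z h1 using 1
  ring

lemma abs_mehlerAvg_deriv_le {g g' : ℝ → ℝ} (hg : ∀ x, HasDerivAt g (g' x) x)
    {C C' : ℝ} (hC : ∀ x, |g x| ≤ C) (hC' : ∀ x, |g' x| ≤ C') (m : ℕ) (x : ℝ) :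
    |mehlerAvg m g' x| ≤ Real.Gamma (((m : ℝ) + 1) / 2) * C
        / (Real.sqrt 2 * Real.Gamma ((m : ℝ) / 2 + 1)) := by
  have hgm' : Measurable g' := by
    rw [show g' = deriv g from funext fun x => (hg x).deriv.symm]
    exact measurable_deriv g
  have hcos : ∀ θ, |Real.cos θ * gaussAvg g' x θ| ≤ √2 / √Real.pi * C := by
    intro θ
    rw [cos_mul_gaussAvg hg hC hC', ← integral_abs_gaussianReal, ← integral_mul_const]
    refine norm_integral_le_of_norm_le (μ := gaussianReal 0 1)
      (f := fun z => z * g (x * Real.sin θ + Real.cos θ * z)) (g := fun z => |z| * C)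
      (Integrable.mul_const ?_ _)
      (ae_of_all _ fun z => ?_)
    · simpa using (integrable_pow_gaussianReal 1).norm
    · rw [norm_mul]
      exact mul_le_mul_of_nonneg_left (hC _) (abs_nonneg _)
  have hfin : ∫ θ in (0 : ℝ)..(Real.pi / 2), Real.sin θ ^ m * (√2 / √Real.pi * C)
      = Real.Gamma (((m : ℝ) + 1) / 2) * C / (Real.sqrt 2 * Real.Gamma ((m : ℝ) / 2 + 1)) := by
    rw [intervalIntegral.integral_mul_const, integral_sin_pow_pi_div_two]
    have h1 : 0 < Real.Gamma ((m : ℝ) / 2 + 1) := Real.Gamma_pos_of_pos (by positivity)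
    have h2 : √2 * √2 = (2 : ℝ) := Real.mul_self_sqrt (by norm_num)
    have h3 := Real.sqrt_pos.2 Real.pi_pos
    field_simp
    rw [sq, h2]
  rw [mehlerAvg_eq hgm' hC', ← hfin, ← Real.norm_eq_abs]
  refine intervalIntegral.norm_integral_le_of_norm_le (μ := volume)
    (g := fun θ => Real.sin θ ^ m * (√2 / √Real.pi * C)) Real.pi_div_two_pos.le
    (ae_of_all _ fun θ hθ => ?_) (Continuous.intervalIntegrable (by fun_prop) _ _)
  have h1 := sin_nonneg_of_mem_quarter hθ
  rw [mul_assoc, norm_mul, Real.norm_of_nonneg (by positivity)]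
  exact mul_le_mul_of_nonneg_left (hcos θ) (by positivity)

/-- The θ-derivative contains z g'(x sin θ + z cos θ); integration by parts turns it into cos θ
times the average of g''. -/
lemma hasDerivAt_gaussAvg {g g' g'' : ℝ → ℝ} (hg : ∀ x, HasDerivAt g (g' x) x)
    (hg' : ∀ x, HasDerivAt g' (g'' x) x) {C C' C'' : ℝ} (hC : ∀ x, |g x| ≤ C)
    (hC' : ∀ x, |g' x| ≤ C') (hC'' : ∀ x, |g'' x| ≤ C'') (x θ : ℝ) :
    HasDerivAt (gaussAvg g x) (x * Real.cos θ * gaussAvg g' x θ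
      - Real.sin θ * (Real.cos θ * gaussAvg g'' x θ)) θ := by
  have hgm : Measurable g :=
    (continuous_iff_continuousAt.2 fun x => (hg x).continuousAt).measurable
  have hgm' : Measurable g' :=
    (continuous_iff_continuousAt.2 fun x => (hg' x).continuousAt).measurable
  have habs : Integrable (fun z : ℝ => |z|) (gaussianReal 0 1) := by
    simpa using (integrable_pow_gaussianReal 1).norm
  have hd := (hasDerivAt_integral_of_dominated_loc_of_deriv_le (x₀ := θ)
    (μ := gaussianReal 0 1)
    (bound := fun z => (|x| + |z|) * C')
    (F := fun θ z => g (x * Real.sin θ + Real.cos θ * z))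
    (F' := fun θ z => (x * Real.cos θ - Real.sin θ * z) * g' (x * Real.sin θ + Real.cos θ * z))
    Filter.univ_mem
    (Filter.Eventually.of_forall fun y => (integrable_comp_affine hgm hC _ _).aestronglyMeasurable)
    (integrable_comp_affine hgm hC _ _) (Measurable.aestronglyMeasurable (by fun_prop))
    (ae_of_all _ fun z y _ => ?_) (((integrable_const _).add habs).mul_const _)
    (ae_of_all _ fun z y _ => ?_)).2
  · convert! hd using 1
    rw [cos_mul_gaussAvg hg' hC' hC'', gaussAvg, ← integral_const_mul, ← integral_const_mul,
      ← integral_sub ((integrable_comp_affine hgm' hC' _ _).const_mul _)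
        ((integrable_mul_comp_affine hgm' hC' _ _).const_mul _)]
    congr 1 with z
    ring
  · rw [norm_mul]
    refine mul_le_mul ?_ (hC' _) (abs_nonneg _) (by positivity)
    refine (abs_sub _ _).trans ?_
    rw [abs_mul, abs_mul]
    have h1 := Real.abs_sin_le_one y
    have h2 := Real.abs_cos_le_one y
    nlinarith [abs_nonneg x, abs_nonneg z]
  · have h1 : HasDerivAt (fun y : ℝ => x * Real.sin y + Real.cos y * z)
        (x * Real.cos y - Real.sin y * z) y := by
      convert! ((Real.hasDerivAt_sin y).const_mul x).add ((Real.hasDerivAt_cos y).mul_const z)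
        using 1
      ring
    convert! (hg _).comp y h1 using 1
    ring

/-- The Stein equation of order `m`, in terms of the averages `mehlerAvg`. -/
lemma mehlerAvg_identity {g g' g'' : ℝ → ℝ} (hg : ∀ x, HasDerivAt g (g' x) x)
    (hg' : ∀ x, HasDerivAt g' (g'' x) x) {C C' C'' : ℝ} (hC : ∀ x, |g x| ≤ C)
    (hC' : ∀ x, |g' x| ≤ C') (hC'' : ∀ x, |g'' x| ≤ C'') (m : ℕ) (x : ℝ) :
    (m : ℝ) * mehlerAvg (m - 1) g x + x * mehlerAvg m g' x - mehlerAvg (m + 1) g'' x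
      = g x - 0 ^ m * normalMean g := by
  have hgm : Measurable g :=
    (continuous_iff_continuousAt.2 fun x => (hg x).continuousAt).measurable
  have hgm' : Measurable g' :=
    (continuous_iff_continuousAt.2 fun x => (hg' x).continuousAt).measurable
  have hgm'' : Measurable g'' := by
    rw [show g'' = deriv g' from funext fun x => (hg' x).deriv.symm]
    exact measurable_deriv g'
  have i0 := (intervalIntegrable_gaussAvg hgm hC (m - 1) x).const_mul (m : ℝ)
  have i1 := (intervalIntegrable_gaussAvg hgm' hC' m x).const_mul x
  have i2 := intervalIntegrable_gaussAvg hgm'' hC'' (m + 1) x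
  -- The identity is the fundamental theorem of calculus for sin^m θ E g(x sin θ + Z cos θ), with
  -- values g(x) at π/2 and 0^m E g(Z) at 0. For m = 0 the truncated exponent m - 1 carries the
  -- coefficient 0.
  have key := intervalIntegral.integral_eq_sub_of_hasDerivAt (a := 0) (b := Real.pi / 2)
    (f := fun θ => Real.sin θ ^ m * gaussAvg g x θ)
    (f' := fun θ => (m : ℝ) * (Real.sin θ ^ (m - 1) * Real.cos θ * gaussAvg g x θ)
      + x * (Real.sin θ ^ m * Real.cos θ * gaussAvg g' x θ)
      - Real.sin θ ^ (m + 1) * Real.cos θ * gaussAvg g'' x θ)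
    (fun θ _ => by
      convert! ((Real.hasDerivAt_sin θ).pow m).mul
        (hasDerivAt_gaussAvg hg hg' hC hC' hC'' x θ) using 1
      simp only [Pi.pow_apply]
      ring)
    ((i0.add i1).sub i2)
  rw [intervalIntegral.integral_sub (i0.add i1) i2, intervalIntegral.integral_add i0 i1,
    intervalIntegral.integral_const_mul, intervalIntegral.integral_const_mul,
    ← mehlerAvg_eq hgm hC, ← mehlerAvg_eq hgm' hC', ← mehlerAvg_eq hgm'' hC''] at key
  rw [key]
  simp [gaussAvg, normalMean]


/-! ### Derivatives of the Stein solution and their bounds -/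

lemma MemCb.abs_le_supNorm {m : ℕ} {h : ℝ → ℝ} (hh : MemCb m h) {k : ℕ} (hk : k ≤ m) (x : ℝ) :
    |iteratedDeriv k h x| ≤ supNorm (iteratedDeriv k h) := by
  obtain ⟨C, hC⟩ := hh.bounded k hk
  exact le_ciSup (f := fun x => |iteratedDeriv k h x|) ⟨C, by rintro _ ⟨y, rfl⟩; exact hC y⟩ x

lemma MemCb.hasDerivAt {m : ℕ} {h : ℝ → ℝ} (hh : MemCb m h) {k : ℕ} (hk : k < m) (x : ℝ) :
    HasDerivAt (iteratedDeriv k h) (iteratedDeriv (k + 1) h x) x := by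
  rw [iteratedDeriv_succ]
  exact (hh.differentiable k hk x).hasDerivAt

lemma measurable_iteratedDeriv_succ (h : ℝ → ℝ) (k : ℕ) : Measurable (iteratedDeriv (k + 1) h) := by
  rw [iteratedDeriv_succ]
  exact measurable_deriv _

/-- The `k`-th derivative of the solution `f` of the Stein equation
`f'(x) - x f(x) = h(x) - Φh`. -/
def steinDeriv (h : ℝ → ℝ) (k : ℕ) (x : ℝ) : ℝ := -mehlerAvg k (iteratedDeriv (k + 1) h) x

variable {p : ℕ} {h : ℝ → ℝ}

lemma hasDerivAt_steinDeriv (hh : MemCb (p + 1) h) {k : ℕ} (hk : k < p) (x : ℝ) :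
    HasDerivAt (steinDeriv h k) (steinDeriv h (k + 1) x) x :=
  (hasDerivAt_mehlerAvg (hh.hasDerivAt (by omega)) (hh.abs_le_supNorm (by omega))
    (hh.abs_le_supNorm (by omega)) k x).neg

lemma measurable_steinDeriv (hh : MemCb (p + 1) h) (hp : 1 ≤ p) {k : ℕ} (hk : k ≤ p) :
    Measurable (steinDeriv h k) := by
  rcases k with _ | k
  · exact (continuous_iff_continuousAt.2 fun x =>
      (hasDerivAt_steinDeriv hh (k := 0) (by omega) x).continuousAt).measurable
  · rw [show steinDeriv h (k + 1) = deriv (steinDeriv h k) from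
      funext fun x => (hasDerivAt_steinDeriv hh (by omega) x).deriv.symm]
    exact measurable_deriv _

lemma abs_steinDeriv_le_div (hh : MemCb (p + 1) h) {k : ℕ} (hk : k ≤ p) (x : ℝ) :
    |steinDeriv h k x| ≤ supNorm (iteratedDeriv (k + 1) h) / ((k : ℝ) + 1) := by
  rw [steinDeriv, abs_neg]
  exact abs_mehlerAvg_le (measurable_iteratedDeriv_succ h k) (hh.abs_le_supNorm (by omega)) k x

/-- The Stein equation differentiated k times; for k ≥ 1 the term with `mehlerAvg (k - 1)` is k
f^(k-1), and the factor `0 ^ k` keeps Φh only at k = 0. -/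
lemma stein_equation (hh : MemCb (p + 1) h) {k : ℕ} (hk : k < p) (x : ℝ) :
    steinDeriv h (k + 1) x = x * steinDeriv h k x
      - (k : ℝ) * mehlerAvg (k - 1) (iteratedDeriv k h) x
      - 0 ^ k * normalMean (iteratedDeriv k h) + iteratedDeriv k h x := by
  have := mehlerAvg_identity (hh.hasDerivAt (k := k) (by omega))
    (hh.hasDerivAt (k := k + 1) (by omega)) (hh.abs_le_supNorm (by omega))
    (hh.abs_le_supNorm (by omega)) (hh.abs_le_supNorm (by omega)) k x
  simp only [steinDeriv]
  linarith

lemma abs_steinDeriv_succ_le_two_mul (hh : MemCb (p + 1) h) {k : ℕ} (hk : k < p) (x : ℝ) :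
    |steinDeriv h (k + 1) x| ≤ 2 * supNorm (iteratedDeriv k h) := by
  set M := supNorm (iteratedDeriv k h)
  have hg : ∀ x, |iteratedDeriv k h x| ≤ M := hh.abs_le_supNorm (by omega)
  have hdv := fun x => hasDerivAt_steinDeriv hh hk x
  -- A is -Φh for k = 0 and k f^(k-1) otherwise. In the latter case the factor k cancels the 1/k in
  -- the bound for f^(k-1), leaving |A| ≤ M.
  have key : ∃ A : ℝ → ℝ, (∀ x, HasDerivAt A ((k : ℝ) * steinDeriv h k x) x) ∧
      (∀ x, |A x| ≤ M) ∧
      ∀ x, steinDeriv h (k + 1) x = x * steinDeriv h k x + A x + iteratedDeriv k h x := by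
    rcases k with _ | k
    · refine ⟨fun _ => -normalMean (iteratedDeriv 0 h), fun x => ?_, fun x => ?_, fun x => ?_⟩
      · simpa using hasDerivAt_const x _
      · rw [abs_neg]
        simpa [normalMean] using norm_integral_le_of_norm_le_const (μ := gaussianReal 0 1)
          (f := iteratedDeriv 0 h) (ae_of_all _ fun z => hg z)
      · rw [stein_equation hh hk]
        simp
        ring
    · refine ⟨fun x => ((k + 1 : ℕ) : ℝ) * steinDeriv h k x, fun x => ?_, fun x => ?_, fun x => ?_⟩
      · exact (hasDerivAt_steinDeriv hh (by omega) x).const_mul _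
      · have := abs_steinDeriv_le_div hh (k := k) (by omega) x
        rw [le_div_iff₀ (by positivity)] at this
        rw [abs_mul, Nat.abs_cast]
        push_cast
        linarith
      · rw [stein_equation hh hk]
        simp only [steinDeriv, Nat.add_sub_cancel]
        ring
  obtain ⟨A, hA, hAM, hv⟩ := key
  have := abs_mul_add_le (k.cast_nonneg (α := ℝ)) (fun x => by rw [← hv x]; exact hdv x) hA hAM hg
    (abs_steinDeriv_le_div hh hk.le) x
  rw [hv x]
  linarith [abs_add_le (x * steinDeriv h k x + A x) (iteratedDeriv k h x), hg x]

lemma abs_steinDeriv_le_gamma (hh : MemCb (p + 1) h) {k : ℕ} (hk : k ≤ p) (x : ℝ) :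
    |steinDeriv h k x| ≤ Real.Gamma (((k : ℝ) + 1) / 2) * supNorm (iteratedDeriv k h)
        / (Real.sqrt 2 * Real.Gamma ((k : ℝ) / 2 + 1)) := by
  rw [steinDeriv, abs_neg]
  exact abs_mehlerAvg_deriv_le (hh.hasDerivAt (by omega)) (hh.abs_le_supNorm (by omega))
    (hh.abs_le_supNorm (by omega)) k x

lemma supNorm_nonneg (f : ℝ → ℝ) : 0 ≤ supNorm f := Real.iSup_nonneg fun _ => abs_nonneg _

lemma abs_steinDeriv_le_steinConst (hh : MemCb (p + 1) h) {k : ℕ} (hk1 : 1 ≤ k) (hk : k ≤ p)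
    (x : ℝ) : |steinDeriv h k x| ≤ steinConst h k := by
  refine le_min ?_ (le_min (abs_steinDeriv_le_gamma hh hk x) (abs_steinDeriv_le_div hh hk x))
  obtain ⟨k, rfl⟩ := Nat.exists_eq_add_of_le' hk1
  have := abs_steinDeriv_succ_le_two_mul hh (k := k) (by omega) x
  rw [Nat.add_sub_cancel]
  linarith [supNorm_nonneg (iteratedDeriv k h)]

lemma abs_steinDeriv_zero_le (hh : MemCb (p + 1) h) (x : ℝ) :
    |steinDeriv h 0 x| ≤ supNorm (deriv h) := by
  simpa using abs_steinDeriv_le_div hh (Nat.zero_le p) x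

lemma stein_equation_zero (hh : MemCb (p + 1) h) (hp : 1 ≤ p) (x : ℝ) :
    h x - normalMean h = steinDeriv h 1 x - x * steinDeriv h 0 x := by
  rw [stein_equation hh (k := 0) (by omega)]
  simp
  ring


/-! ### Expansion of one summand -/

lemma integrable_abs_pow_of_le {Ω : Type*} [MeasurableSpace Ω] {μ : Measure Ω}
    [IsFiniteMeasure μ] {Y : Ω → ℝ} (hY : Measurable Y) {m k : ℕ}
    (hmom : Integrable (fun ω => |Y ω| ^ m) μ) (hk : k ≤ m) :
    Integrable (fun ω => |Y ω| ^ k) μ := by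
  refine Integrable.mono' ((integrable_const (1 : ℝ)).add hmom)
    (Measurable.aestronglyMeasurable (by fun_prop)) (ae_of_all _ fun ω => ?_)
  rw [Real.norm_of_nonneg (by positivity)]
  simp only [Pi.add_apply]
  rcases le_total |Y ω| 1 with h1 | h1
  · linarith [pow_le_one₀ (n := k) (abs_nonneg (Y ω)) h1, pow_nonneg (abs_nonneg (Y ω)) m]
  · linarith [pow_le_pow_right₀ h1 hk]

/-- The contribution of one summand: `F k` is the `k`-th derivative of a function `F 0`, and `U` is
independent of `Y`. -/
lemma abs_integral_summand_le {Ω : Type*} [MeasurableSpace Ω] {μ : Measure Ω}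
    [IsProbabilityMeasure μ] {q : ℕ} {F : ℕ → ℝ → ℝ} {b : ℕ → ℝ} {s : ℝ} {U Y : Ω → ℝ}
    (hF : ∀ k < q + 1, ∀ x, HasDerivAt (F k) (F (k + 1) x) x)
    (hFm : ∀ k ≤ q + 1, Measurable (F k)) (hb : ∀ k ≤ q + 1, ∀ x, |F k x| ≤ b k) (hs : 0 ≤ s)
    (hU : Measurable U) (hY : Measurable Y) (hUY : IndepFun U Y μ)
    (hmom : Integrable (fun ω => |Y ω| ^ (q + 2)) μ) :
    |∫ ω, (s ^ 2 * F 1 (U ω + s * Y ω) - s * Y ω * F 0 (U ω + s * Y ω)) ∂μ|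
      ≤ b 0 * s * |∫ ω, Y ω ∂μ|
        + ∑ j ∈ Finset.range q, b (j + 1) * s ^ (j + 2) / ((j + 1).factorial : ℝ)
            * |((j : ℝ) + 1) * (∫ ω, Y ω ^ j ∂μ) - ∫ ω, Y ω ^ (j + 2) ∂μ|
        + b (q + 1) * s ^ (q + 2) * ((∫ ω, |Y ω| ^ q ∂μ) / (q.factorial : ℝ)
            + (∫ ω, |Y ω| ^ (q + 2) ∂μ) / ((q + 1).factorial : ℝ)) := by
  have hYabs : ∀ k ≤ q + 2, Integrable (fun ω => |Y ω| ^ k) μ := by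
    intro k hk
    exact integrable_abs_pow_of_le hY hmom hk
  have hYpow : ∀ k ≤ q + 2, Integrable (fun ω => Y ω ^ k) μ := by
    intro k hk
    refine (integrable_norm_iff (Measurable.aestronglyMeasurable (by fun_prop))).1 ?_
    simpa using hYabs k hk
  have hY1 : Integrable Y μ := by simpa using hYpow 1 (by omega)
  have hprod : ∀ k ≤ q + 1, ∀ j ≤ q + 2, Integrable (fun ω => F k (U ω) * Y ω ^ j) μ := by
    intro k hk j hj
    exact (hYpow j hj).bdd_mul (c := b k)
      ((hFm k hk).comp hU).aestronglyMeasurable (ae_of_all _ fun ω => hb k hk _)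
  have hfac : ∀ k ≤ q + 1, ∀ j, ∫ ω, F k (U ω) * Y ω ^ j ∂μ
      = (∫ ω, F k (U ω) ∂μ) * ∫ ω, Y ω ^ j ∂μ := by
    intro k hk j
    exact (hUY.comp (hFm k hk) (measurable_id.pow_const j)).integral_fun_mul_eq_mul_integral
      ((hFm k hk).comp hU).aestronglyMeasurable (hY.pow_const j).aestronglyMeasurable
  have hmean : ∀ k ≤ q + 1, |∫ ω, F k (U ω) ∂μ| ≤ b k := by
    intro k hk
    simpa using norm_integral_le_of_norm_le_const (μ := μ) (f := fun ω => F k (U ω))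
      (ae_of_all _ fun ω => hb k hk _)
  set L : Ω → ℝ := fun ω => s ^ 2 * F 1 (U ω + s * Y ω) - s * Y ω * F 0 (U ω + s * Y ω) with hL
  -- D is the polynomial part of L in Y, with index j = k - 1; independence factorises its
  -- expectation.
  set D : Ω → ℝ := fun ω => -s * (F 0 (U ω) * Y ω ^ 1)
    + ∑ j ∈ Finset.range q, s ^ (j + 2) / ((j + 1).factorial : ℝ)
      * (((j : ℝ) + 1) * (F (j + 1) (U ω) * Y ω ^ j) - F (j + 1) (U ω) * Y ω ^ (j + 2)) with hD
  have hLint : Integrable L μ := by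
    have hW : Measurable fun ω => U ω + s * Y ω := by fun_prop
    refine Integrable.sub (Integrable.const_mul ?_ _) ?_
    · exact Integrable.of_bound (C := b 1) ((hFm 1 (by omega)).comp hW).aestronglyMeasurable
        (ae_of_all _ fun ω => hb 1 (by omega) _)
    · exact (hY1.const_mul s).mul_bdd (c := b 0)
        ((hFm 0 (by omega)).comp hW).aestronglyMeasurable (ae_of_all _ fun ω => hb 0 (by omega) _)
  have hterm : ∀ j ∈ Finset.range q, Integrable (fun ω => s ^ (j + 2) / ((j + 1).factorial : ℝ)
      * (((j : ℝ) + 1) * (F (j + 1) (U ω) * Y ω ^ j) - F (j + 1) (U ω) * Y ω ^ (j + 2))) μ := by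
    intro j hj
    rw [Finset.mem_range] at hj
    exact (((hprod _ (by omega) _ (by omega)).const_mul _).sub
      (hprod _ (by omega) _ (by omega))).const_mul _
  have hDint : Integrable D μ :=
    ((hprod 0 (by omega) 1 (by omega)).const_mul _).add (integrable_finsetSum _ hterm)
  have hDval : ∫ ω, D ω ∂μ = -s * ((∫ ω, F 0 (U ω) ∂μ) * ∫ ω, Y ω ∂μ)
      + ∑ j ∈ Finset.range q, s ^ (j + 2) / ((j + 1).factorial : ℝ)
        * ((∫ ω, F (j + 1) (U ω) ∂μ)
          * (((j : ℝ) + 1) * (∫ ω, Y ω ^ j ∂μ) - ∫ ω, Y ω ^ (j + 2) ∂μ)) := by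
    rw [hD, integral_add ((hprod 0 (by omega) 1 (by omega)).const_mul _)
      (integrable_finsetSum _ hterm), integral_const_mul, hfac 0 (by omega),
      integral_finsetSum _ hterm]
    simp only [pow_one]
    congr 1
    refine Finset.sum_congr rfl fun j hj => ?_
    rw [Finset.mem_range] at hj
    rw [integral_const_mul, integral_sub ((hprod _ (by omega) _ (by omega)).const_mul _)
      (hprod _ (by omega) _ (by omega)), integral_const_mul, hfac _ (by omega), hfac _ (by omega)]
    ring
  have hrem : ∀ ω, ‖L ω - D ω‖ ≤ b (q + 1) * s ^ (q + 2)
      * (|Y ω| ^ q / (q.factorial : ℝ) + |Y ω| ^ (q + 2) / ((q + 1).factorial : ℝ)) := by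
    intro ω
    -- `F 0` is expanded one order further than `F 1`, so that both remainders involve `F (q + 1)`.
    have t0 := abs_sub_taylor_le (q + 1) hF (hb (q + 1) le_rfl) (U ω) (s * Y ω)
    have t1 := abs_sub_taylor_le q (F := fun k => F (k + 1)) (fun k hk => hF (k + 1) (by omega))
      (hb (q + 1) le_rfl) (U ω) (s * Y ω)
    set r0 := F 0 (U ω + s * Y ω)
      - ∑ k ∈ Finset.range (q + 1), F k (U ω) * (s * Y ω) ^ k / (k.factorial : ℝ) with hr0
    set r1 := F (0 + 1) (U ω + s * Y ω)
      - ∑ k ∈ Finset.range q, F (k + 1) (U ω) * (s * Y ω) ^ k / (k.factorial : ℝ) with hr1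
    have hdecomp : L ω - D ω = s ^ 2 * r1 - s * Y ω * r0 := by
      have hsum : s ^ 2 * ∑ k ∈ Finset.range q,
            F (k + 1) (U ω) * (s * Y ω) ^ k / (k.factorial : ℝ)
          - s * Y ω * ∑ k ∈ Finset.range (q + 1),
            F k (U ω) * (s * Y ω) ^ k / (k.factorial : ℝ) = D ω := by
        -- Splitting off the order-zero term of `F 0` pairs its term j + 1 with term j of `F 1`:
        -- both carry `F (j + 1)` and s^(j+2).
        rw [Finset.sum_range_succ', mul_add, Finset.mul_sum, Finset.mul_sum, ← sub_sub,
          ← Finset.sum_sub_distrib, hD, sub_eq_add_neg, add_comm]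
        congr 1
        · simp
          ring
        · refine Finset.sum_congr rfl fun j _ => ?_
          rw [Nat.factorial_succ]
          push_cast
          have : (j.factorial : ℝ) ≠ 0 := by positivity
          field_simp
          ring
      rw [← hsum, hr0, hr1, hL]
      simp only [zero_add]
      ring
    rw [hdecomp]
    have hsY : |s * Y ω| = s * |Y ω| := by rw [abs_mul, abs_of_nonneg hs]
    calc ‖s ^ 2 * r1 - s * Y ω * r0‖ ≤ |s ^ 2 * r1| + |s * Y ω * r0| := abs_sub _ _
      _ = s ^ 2 * |r1| + s * |Y ω| * |r0| := by
          rw [abs_mul, abs_of_nonneg (sq_nonneg s), abs_mul, hsY]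
      _ ≤ s ^ 2 * (b (q + 1) * |s * Y ω| ^ q / (q.factorial : ℝ))
          + s * |Y ω| * (b (q + 1) * |s * Y ω| ^ (q + 1) / ((q + 1).factorial : ℝ)) := by
          gcongr
      _ = _ := by rw [hsY]; ring
  have hRbound : |∫ ω, (L ω - D ω) ∂μ| ≤ b (q + 1) * s ^ (q + 2)
      * ((∫ ω, |Y ω| ^ q ∂μ) / (q.factorial : ℝ)
        + (∫ ω, |Y ω| ^ (q + 2) ∂μ) / ((q + 1).factorial : ℝ)) := by
    have i1 := (hYabs q (by omega)).div_const (q.factorial : ℝ)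
    have i2 := (hYabs (q + 2) le_rfl).div_const ((q + 1).factorial : ℝ)
    rw [← integral_div, ← integral_div, ← integral_add i1 i2, ← integral_const_mul]
    exact norm_integral_le_of_norm_le ((i1.add i2).const_mul _) (ae_of_all _ hrem)
  have hDbound : |∫ ω, D ω ∂μ| ≤ b 0 * s * |∫ ω, Y ω ∂μ|
        + ∑ j ∈ Finset.range q, b (j + 1) * s ^ (j + 2) / ((j + 1).factorial : ℝ)
            * |((j : ℝ) + 1) * (∫ ω, Y ω ^ j ∂μ) - ∫ ω, Y ω ^ (j + 2) ∂μ| := by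
    rw [hDval]
    refine (abs_add_le _ _).trans (add_le_add ?_ ((Finset.abs_sum_le_sum_abs _ _).trans
      (Finset.sum_le_sum fun j hj => ?_)))
    · rw [abs_mul, abs_neg, abs_of_nonneg hs, abs_mul]
      calc _ ≤ s * (b 0 * |∫ ω, Y ω ∂μ|) := by gcongr; exact hmean 0 (by omega)
        _ = _ := by ring
    · rw [Finset.mem_range] at hj
      rw [abs_mul, abs_of_nonneg (by positivity), abs_mul]
      calc _ ≤ s ^ (j + 2) / ((j + 1).factorial : ℝ) * (b (j + 1)
            * |((j : ℝ) + 1) * (∫ ω, Y ω ^ j ∂μ) - ∫ ω, Y ω ^ (j + 2) ∂μ|) := by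
            gcongr; exact hmean (j + 1) (by omega)
        _ = _ := by ring
  have hsplit : ∫ ω, L ω ∂μ = (∫ ω, D ω ∂μ) + ∫ ω, (L ω - D ω) ∂μ := by
    rw [integral_sub hLint hDint]; ring
  rw [hsplit]
  exact (abs_add_le _ _).trans (add_le_add hDbound hRbound)

lemma momentDiff_one {Ω : Type*} [MeasurableSpace Ω] (μ : Measure Ω) (Y : Ω → ℝ) :
    momentDiff μ Y 1 = ∫ ω, Y ω ∂μ := by
  simp [momentDiff, integral_id_gaussianReal]

/-- The Gaussian moments cancel by their recursion. -/
lemma mul_momentDiff_sub {Ω : Type*} [MeasurableSpace Ω] (μ : Measure Ω) (Y : Ω → ℝ) (j : ℕ) :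
    ((j : ℝ) + 1) * momentDiff μ Y j - momentDiff μ Y (j + 2)
      = ((j : ℝ) + 1) * (∫ ω, Y ω ^ j ∂μ) - ∫ ω, Y ω ^ (j + 2) ∂μ := by
  rw [momentDiff, momentDiff, integral_pow_gaussianReal]
  ring

lemma rpow_add_one_div_two (n k : ℕ) :
    (n : ℝ) ^ (((k : ℝ) + 1) / 2) = √(n : ℝ) ^ (k + 1) := by
  rw [Real.sqrt_eq_rpow, ← Real.rpow_natCast, ← Real.rpow_mul (by positivity)]
  congr 1
  push_cast
  ring

end

end SteinMoments

/-! ### Summation over the variables -/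

open SteinMoments in
theorem mainTheorem3 {Ω : Type*} [MeasurableSpace Ω] (μ : Measure Ω) [IsProbabilityMeasure μ]
    (n p : ℕ) (hn : 1 ≤ n) (hp : 1 ≤ p) (X : Fin n → Ω → ℝ)
    (hX : ∀ i, Measurable (X i)) (hindep : iIndepFun X μ)
    (hmom : ∀ i, Integrable (fun ω => |X i ω| ^ (p + 1)) μ)
    (h : ℝ → ℝ) (hh : SteinMoments.MemCb (p + 1) h) :
    |(∫ ω, h (SteinMoments.stdSum X ω) ∂μ) - SteinMoments.normalMean h| ≤
      SteinMoments.supNorm (deriv h) / Real.sqrt (n : ℝ)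
          * ∑ i, |SteinMoments.momentDiff μ (X i) 1|
        + ∑ i, ∑ k ∈ Finset.Icc 1 (p - 1),
            SteinMoments.steinConst h k / ((k.factorial : ℝ) * (n : ℝ) ^ (((k : ℝ) + 1) / 2))
              * |(k : ℝ) * SteinMoments.momentDiff μ (X i) (k - 1)
                  - SteinMoments.momentDiff μ (X i) (k + 1)|
        + SteinMoments.steinConst h p / (n : ℝ) ^ (((p : ℝ) + 1) / 2)
            * ∑ i, ((∫ ω, |X i ω| ^ (p - 1) ∂μ) / ((p - 1).factorial : ℝ)
                + (∫ ω, |X i ω| ^ (p + 1) ∂μ) / (p.factorial : ℝ)) := by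
  obtain ⟨q, rfl⟩ := Nat.exists_eq_add_of_le' hp
  have hsqrt : 0 < √(n : ℝ) := Real.sqrt_pos.2 (by exact_mod_cast hn)
  set s : ℝ := 1 / √(n : ℝ) with hs
  have hs0 : 0 ≤ s := by positivity
  -- N_k is meant only for k ≥ 1; f itself is bounded by ‖h'‖.
  set b : ℕ → ℝ := fun k => if k = 0 then supNorm (deriv h) else steinConst h k with hbdef
  have hb : ∀ k ≤ q + 1, ∀ x, |steinDeriv h k x| ≤ b k := by
    intro k hk x
    rcases Nat.eq_zero_or_pos k with rfl | hk0
    · simpa [hbdef] using abs_steinDeriv_zero_le hh x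
    · simpa [hbdef, hk0.ne'] using abs_steinDeriv_le_steinConst hh hk0 hk x
  set U : Fin n → Ω → ℝ := fun i ω => s * (∑ j ∈ Finset.univ.erase i, X j) ω with hU
  have hUm : ∀ i, Measurable (U i) := fun i => by
    simp only [hU, Finset.sum_apply]
    exact (Finset.measurable_sum (Finset.univ.erase i) fun j _ => hX j).const_mul s
  have hUX : ∀ i, IndepFun (U i) (X i) μ := fun i =>
    (hindep.indepFun_finsetSum_of_notMem hX (Finset.notMem_erase i _)).comp
      (measurable_const_mul s) measurable_id
  have hW : ∀ i ω, stdSum X ω = U i ω + s * X i ω := by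
    intro i ω
    rw [stdSum, ← Finset.sum_erase_add _ _ (Finset.mem_univ i), mul_add]
    simp only [hU, hs, Finset.sum_apply]
  have hWm : Measurable (stdSum X) :=
    (Finset.measurable_sum Finset.univ fun j _ => hX j).const_mul s
  set Lᵢ : Fin n → Ω → ℝ := fun i ω => s ^ 2 * steinDeriv h 1 (U i ω + s * X i ω)
    - s * X i ω * steinDeriv h 0 (U i ω + s * X i ω) with hLᵢ
  have hXint : ∀ i, Integrable (X i) μ := by
    intro i
    refine (integrable_norm_iff (hX i).aestronglyMeasurable).1 ?_
    simpa using integrable_abs_pow_of_le (hX i) (hmom i) (show 1 ≤ q + 1 + 1 by omega)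
  have hLint : ∀ i, Integrable (Lᵢ i) μ := by
    intro i
    simp only [hLᵢ, ← hW]
    refine Integrable.sub (Integrable.const_mul ?_ _) ?_
    · exact Integrable.of_bound (C := b 1)
        ((measurable_steinDeriv hh hp (by omega)).comp hWm).aestronglyMeasurable
        (ae_of_all _ fun ω => hb 1 (by omega) _)
    · exact ((hXint i).const_mul s).mul_bdd (c := b 0)
        ((measurable_steinDeriv hh hp (by omega)).comp hWm).aestronglyMeasurable
        (ae_of_all _ fun ω => hb 0 (by omega) _)
  have hstein : (∫ ω, h (stdSum X ω) ∂μ) - normalMean h = ∑ i, ∫ ω, Lᵢ i ω ∂μ := by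
    have hhm : Measurable h := by
      simpa using (hh.differentiable 0 (by omega)).continuous.measurable
    have hhint : Integrable (fun ω => h (stdSum X ω)) μ :=
      Integrable.of_bound (C := supNorm h) (hhm.comp hWm).aestronglyMeasurable
        (ae_of_all _ fun ω => by simpa using hh.abs_le_supNorm (k := 0) (by omega) (stdSum X ω))
    -- This shares f'(W) equally among the n summands.
    have hns : (n : ℝ) * s ^ 2 = 1 := by
      rw [hs, div_pow, Real.sq_sqrt (by positivity), one_pow]
      exact mul_one_div_cancel (by positivity)
    have hconst : normalMean h = ∫ _ω, normalMean h ∂μ := by simp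
    rw [hconst, ← integral_sub hhint (integrable_const _),
      ← integral_finsetSum _ fun i _ => hLint i]
    congr 1 with ω
    simp only [hLᵢ, ← hW]
    rw [stein_equation_zero hh hp, Finset.sum_sub_distrib, ← Finset.sum_mul, ← Finset.sum_mul,
      ← Finset.mul_sum, Finset.sum_const, Finset.card_univ, Fintype.card_fin, nsmul_eq_mul, hns,
      one_mul, stdSum]
  rw [hstein]
  have hbound := fun i => abs_integral_summand_le (fun k hk x => hasDerivAt_steinDeriv hh hk x)
    (fun k hk => measurable_steinDeriv hh hp hk) hb hs0 (hUm i) (hX i) (hUX i) (hmom i)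
  refine (Finset.abs_sum_le_sum_abs _ _).trans
    ((Finset.sum_le_sum fun i _ => hbound i).trans_eq ?_)
  rw [Finset.sum_add_distrib, Finset.sum_add_distrib, ← Finset.mul_sum, ← Finset.mul_sum]
  congr 1
  · congr 1
    · simp only [momentDiff_one, hbdef, hs, if_true]
      ring
    · refine Finset.sum_congr rfl fun i _ => ?_
      rw [Nat.add_sub_cancel, ← Finset.Ico_add_one_right_eq_Icc, Finset.sum_Ico_eq_sum_range,
        Nat.add_sub_cancel]
      refine Finset.sum_congr rfl fun j _ => ?_
      have hmd := mul_momentDiff_sub μ (X i) j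
      rw [add_comm 1 j, rpow_add_one_div_two, Nat.add_sub_cancel, Nat.cast_add_one, hmd]
      simp only [hbdef, hs, Nat.add_one_ne_zero, if_false, div_pow, one_pow]
      ring
  · simp only [rpow_add_one_div_two, hbdef, hs, Nat.add_sub_cancel, Nat.add_one_ne_zero, if_false,
      div_pow, one_pow, mul_one_div]
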